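/- There is a universal constant $C>0$ with the following property. Let $\lambda=(\lambda_n)_{n\ge 1}$ be any frequency, i.e. a strictly increasing sequence of non-negative real numbers tending to $+\infty$. Let $D=\sum a_n e^{-\lambda_n s}$, with complex coefficients $a_n$, be a Dirichlet series that converges at some point of $\mathbb{C}$ and whose limit function (defined on the half plane $[\mathrm{Re}>\sigma_c(D)]$, where $\sigma_c(D)$ is the abscissa of convergence) has a holomorphic and bounded extension $f$ to the half plane $[\mathrm{Re}>0]$, meaning that $f$ is holomorphic and bounded on $[\mathrm{Re}>0]$ and $f(s)=\sum_{n=1}^{\infty}a_ne^{-\lambda_n s}$ whenever $\mathrm{Re}\,s>\max(0,\sigma_c(D))$; put $\|D\|_\infty:=\sup_{\mathrm{Re}\,s>0}|f(s)|$. Then for all real $0<k\le 1$ and all integers $N\ge 1$, $$\sup_{\mathrm{Re}\,s>0}\left|\sum_{n=1}^{N}a_n e^{-\lambda_n s}\right|\le C\,\frac{\Gamma(k+1)}{k}\left(\frac{\lambda_{N+1}}{\lambda_{N+1}-\lambda_N}\right)^{k}\|D\|_\infty ,$$ where $\Gamma$ denotes the Gamma function. -/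

import Mathlib

namespace GenDirichlet

/-- The open right half plane `[Re > 0]`. -/
def rightHalfPlane : Set ℂ := {s : ℂ | 0 < s.re}

/-- A frequency: a strictly increasing sequence of non-negative reals tending to `+∞`.
Sequences are indexed from `0`, so `lam n` is the `(n+1)`-st term `λ_{n+1}`. -/
structure IsFrequency (lam : ℕ → ℝ) : Prop where
  strictMono : StrictMono lam
  nonneg : ∀ n, 0 ≤ lam n
  tendsto_atTop : Filter.Tendsto lam Filter.atTop Filter.atTop

/-- The sum of the first `N` terms of `∑ aₙ e^{-λₙ s}`; the formal series is identified with its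
coefficient sequence `a`. -/
noncomputable def partialSum (lam : ℕ → ℝ) (a : ℕ → ℂ) (N : ℕ) (s : ℂ) : ℂ :=
  ∑ n ∈ Finset.range N, a n * Complex.exp (-(lam n : ℂ) * s)

/-- The series converges at `s` with sum `z` (convergence of partial sums, not necessarily
absolute). -/
def HasValueAt (lam : ℕ → ℝ) (a : ℕ → ℂ) (s z : ℂ) : Prop :=
  Filter.Tendsto (fun N => partialSum lam a N s) Filter.atTop (nhds z)

def ConvergesAt (lam : ℕ → ℝ) (a : ℕ → ℂ) (s : ℂ) : Prop :=
  ∃ z, HasValueAt lam a s z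

/-- The abscissa of convergence `σ_c(D) = inf {σ ∈ ℝ | D converges on [Re > σ]}`. -/
noncomputable def convAbscissa (lam : ℕ → ℝ) (a : ℕ → ℂ) : EReal :=
  sInf ((fun σ : ℝ => (σ : EReal)) '' {σ : ℝ | ∀ s : ℂ, σ < s.re → ConvergesAt lam a s})

/-- `f` (on `[Re > 0]`) is a bounded holomorphic extension of the limit function of the series:
it agrees with the sum of the series on `[Re > σ_c] ∩ [Re > 0]`. -/
structure IsBoundedExtension (lam : ℕ → ℝ) (a : ℕ → ℂ) (f : ℂ → ℂ) : Prop where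
  holomorphic : DifferentiableOn ℂ f rightHalfPlane
  bounded : ∃ M : ℝ, ∀ s ∈ rightHalfPlane, ‖f s‖ ≤ M
  extends_sum : ∀ s ∈ rightHalfPlane, convAbscissa lam a < (s.re : EReal) →
    HasValueAt lam a s (f s)

/-- The space `D_∞^ext(λ)` of somewhere convergent series that admit a bounded holomorphic
extension to `[Re > 0]`. -/
def DInftyExt (lam : ℕ → ℝ) : Set (ℕ → ℂ) :=
  {a | (∃ s, ConvergesAt lam a s) ∧ ∃ f, IsBoundedExtension lam a f}

/-- `sup_{[Re > 0]} |f|`, for `f` bounded on `[Re > 0]`. It is `‖D‖_∞` when `f` is the bounded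
extension of `D`. -/
noncomputable def supNorm (f : ℂ → ℂ) : ℝ := ⨆ s : rightHalfPlane, ‖f s‖

end GenDirichlet

open MeasureTheory Set Filter
open scoped FourierTransform SchwartzMap Topology

/-! A partial sum of `D` is an average of `f` along a vertical line, against an integrable kernel
whose Fourier transform is `1` at the frequencies up to `lam N` and `0` from `lam (N + 1)` on; hence
it is at most the L¹ norm of the kernel times `supNorm f`. Such a transform is the indicator of
`[-r, r]` convolved with a bump `ρ`: after scaling by half the gap, the transition width is fixed
and only `r` varies. The kernel is then `dirichletKernel r * 𝓕 ρ`, of L¹ norm `O(r ^ k / k)`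
(`exists_integral_norm_truncKernel_le`), and `r` is at most twice the quotient in the theorem. The
averaging formula is proved by termwise integration where the series converges
(`partialSum_eq_integral_of_re_gt`) and extended by the identity theorem (`partialSum_eq_integral`).
The Gamma factor is harmless, being bounded below. -/

namespace GenDirichlet

/-! ### The truncation kernel: Fourier transform and L¹ norm. -/

/-- A smooth function of integral one supported in `[-1, 1]`. -/
theorem exists_schwartz_bump :
    ∃ ρ : 𝓢(ℝ, ℂ), (∀ x, 1 ≤ |x| → ρ x = 0) ∧ ∫ x, ρ x = 1 := by
  let b : ContDiffBump (0 : ℝ) := ⟨1 / 2, 1, by norm_num, by norm_num⟩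
  have hc : HasCompactSupport (fun x => ((b.normed volume x : ℝ) : ℂ)) :=
    b.hasCompactSupport_normed.comp_left (g := fun x : ℝ => (x : ℂ)) Complex.ofReal_zero
  have hd : ContDiff ℝ (⊤ : ℕ∞) (fun x => ((b.normed volume x : ℝ) : ℂ)) :=
    Complex.ofRealCLM.contDiff.comp b.contDiff_normed
  refine ⟨hc.toSchwartzMap hd, fun x hx => ?_, ?_⟩
  · have hx' : x ∉ Function.support (b.normed volume) := by
      rw [b.support_normed_eq]
      simpa [b] using hx
    simpa using hx'
  · calc ∫ x, (hc.toSchwartzMap hd) x = ∫ x, ((b.normed volume x : ℝ) : ℂ) := rfl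
      _ = 1 := by rw [integral_complex_ofReal, b.integral_normed, Complex.ofReal_one]

/-- The Fourier transform of the indicator function of `[-r, r]`. -/
noncomputable def dirichletKernel (r t : ℝ) : ℂ :=
  ∫ u in -r..r, Complex.exp ((2 * Real.pi * u * t : ℝ) * Complex.I)

theorem norm_dirichletKernel_le {r : ℝ} (hr : 0 ≤ r) (t : ℝ) : ‖dirichletKernel r t‖ ≤ 2 * r := by
  have := intervalIntegral.norm_integral_le_of_norm_le_const (a := -r) (b := r) (C := 1)
    (f := fun u : ℝ => Complex.exp ((2 * Real.pi * u * t : ℝ) * Complex.I))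
    (fun u _ => (Complex.norm_exp_ofReal_mul_I _).le)
  rw [abs_of_nonneg (by linarith)] at this
  unfold dirichletKernel
  linarith

theorem norm_dirichletKernel_le_inv (r : ℝ) {t : ℝ} (ht : t ≠ 0) :
    ‖dirichletKernel r t‖ ≤ |t|⁻¹ := by
  have hc : (2 * Real.pi * t : ℂ) * Complex.I ≠ 0 := by
    have := Real.pi_ne_zero
    simp [ht]
  have h : dirichletKernel r t =
      (Complex.exp ((2 * Real.pi * r * t : ℝ) * Complex.I) -
        Complex.exp ((2 * Real.pi * (-r) * t : ℝ) * Complex.I)) /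
        ((2 * Real.pi * t : ℂ) * Complex.I) := by
    have := integral_exp_mul_complex (a := -r) (b := r) hc
    unfold dirichletKernel
    convert this using 2
    · ext u
      push_cast
      ring_nf
    · push_cast
      ring_nf
  have hp : (0 : ℝ) < |t| := abs_pos.2 ht
  rw [h, norm_div]
  have hn : ‖(2 * Real.pi * t : ℂ) * Complex.I‖ = 2 * Real.pi * |t| := by
    simp [abs_of_pos Real.pi_pos]
  rw [hn, div_le_iff₀ (by have := Real.pi_pos; positivity)]
  calc _ ≤ (1 : ℝ) + 1 := (norm_sub_le _ _).trans
        (by rw [Complex.norm_exp_ofReal_mul_I, Complex.norm_exp_ofReal_mul_I])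
    _ ≤ 2 * Real.pi := by linarith [Real.pi_gt_three]
    _ = |t|⁻¹ * (2 * Real.pi * |t|) := by field_simp

/-- Interpolation: the uniform bound to the power `k` times the decay bound to the power `1 - k`. -/
theorem norm_dirichletKernel_le_rpow {r k t : ℝ} (hr : 0 < r) (hk : 0 < k) (hk1 : k ≤ 1)
    (ht : t ≠ 0) : ‖dirichletKernel r t‖ ≤ 2 * r ^ k * |t| ^ (k - 1) := by
  have hp : (0 : ℝ) < |t| := abs_pos.2 ht
  set D := ‖dirichletKernel r t‖ with hD
  have hD0 : 0 ≤ D := norm_nonneg _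
  have h2 : (2 : ℝ) ^ k ≤ 2 := by
    simpa using Real.rpow_le_rpow_of_exponent_le (by norm_num : (1 : ℝ) ≤ 2) hk1
  calc D = D ^ k * D ^ (1 - k) := by
        rw [← Real.rpow_add_of_nonneg hD0 hk.le (by linarith)]
        simp
    _ ≤ (2 * r) ^ k * (|t|⁻¹) ^ (1 - k) := by
        gcongr
        · exact norm_dirichletKernel_le hr.le t
        · exact norm_dirichletKernel_le_inv r ht
    _ = 2 ^ k * (r ^ k * |t| ^ (k - 1)) := by
        rw [Real.mul_rpow (by norm_num) hr.le, Real.inv_rpow hp.le, ← Real.rpow_neg hp.le]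
        ring_nf
    _ ≤ 2 * (r ^ k * |t| ^ (k - 1)) := by gcongr
    _ = _ := by ring

theorem continuous_dirichletKernel (r : ℝ) : Continuous (dirichletKernel r) := by
  unfold dirichletKernel
  exact intervalIntegral.continuous_parametric_intervalIntegral_of_continuous' (by fun_prop) _ _

/-- The truncation kernel: its Fourier transform is the convolution of the indicator function of
`[-r, r]` with `ρ`. -/
noncomputable def truncKernel (ρ : 𝓢(ℝ, ℂ)) (r t : ℝ) : ℂ :=
  dirichletKernel r t * (𝓕 ρ) t

theorem continuous_truncKernel (ρ : 𝓢(ℝ, ℂ)) (r : ℝ) : Continuous (truncKernel ρ r) :=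
  (continuous_dirichletKernel r).mul (𝓕 ρ).continuous

/-- The weight `1 + |t|` matches the linear growth in `t` of the Abel bound for partial sums on a
vertical line. -/
theorem integrable_one_add_abs_mul_truncKernel (ρ : 𝓢(ℝ, ℂ)) {r : ℝ} (hr : 0 ≤ r) :
    Integrable (fun t => (1 + |t|) * ‖truncKernel ρ r t‖) := by
  have h0 : Integrable (fun t => ‖(𝓕 ρ) t‖) := (𝓕 ρ).integrable.norm
  have h1 : Integrable (fun t => ‖t‖ ^ 1 * ‖(𝓕 ρ) t‖) := (𝓕 ρ).integrable_pow_mul volume 1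
  refine Integrable.mono' ((h0.add h1).const_mul (2 * r)) ?_ (ae_of_all _ fun t => ?_)
  · exact ((by fun_prop : Continuous fun t : ℝ => 1 + |t|).mul
      (continuous_truncKernel ρ r).norm).aestronglyMeasurable
  · rw [Real.norm_of_nonneg (by positivity), truncKernel, norm_mul]
    calc (1 + |t|) * (‖dirichletKernel r t‖ * ‖(𝓕 ρ) t‖)
        ≤ (1 + |t|) * (2 * r * ‖(𝓕 ρ) t‖) := by
          gcongr
          exact norm_dirichletKernel_le hr t
      _ = _ := by
          simp only [Pi.add_apply, Real.norm_eq_abs]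
          ring

theorem integrable_truncKernel (ρ : 𝓢(ℝ, ℂ)) {r : ℝ} (hr : 0 ≤ r) :
    Integrable (truncKernel ρ r) := by
  refine Integrable.mono' (integrable_one_add_abs_mul_truncKernel ρ hr)
    (continuous_truncKernel ρ r).aestronglyMeasurable (ae_of_all _ fun t => ?_)
  have := abs_nonneg t
  have := norm_nonneg (truncKernel ρ r t)
  nlinarith

/-- Fourier inversion for `ρ`, then Fubini. As `ρ` lives in `[-1, 1]`, the value is `1` or `0`
according as the window `[-r - x, r - x]` contains or misses that interval. -/
theorem integral_exp_mul_truncKernel (ρ : 𝓢(ℝ, ℂ)) (r x : ℝ) :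
    ∫ t : ℝ, Complex.exp ((-(2 * Real.pi * x * t) : ℝ) * Complex.I) * truncKernel ρ r t =
      ∫ u in -r..r, ρ (u - x) := by
  have hinv : ∀ y : ℝ, ρ y = ∫ t : ℝ, Complex.exp ((2 * Real.pi * y * t : ℝ) * Complex.I) *
      (𝓕 ρ) t := by
    intro y
    have h : 𝓕⁻ (𝓕 ρ) = ρ := FourierTransform.fourierInv_fourier_eq ρ
    conv_lhs => rw [← h]
    rw [SchwartzMap.fourierInv_coe, Real.fourierInv_eq']
    refine integral_congr_ae (ae_of_all _ fun t => ?_)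
    simp only [smul_eq_mul, RCLike.inner_apply, conj_trivial]
    ring_nf
  simp_rw [hinv]
  rw [intervalIntegral_integral_swap]
  · refine integral_congr_ae (ae_of_all _ fun t => ?_)
    simp only [truncKernel, dirichletKernel]
    rw [← mul_assoc, ← intervalIntegral.integral_const_mul,
      ← intervalIntegral.integral_mul_const]
    congr 1
    ext u
    rw [← Complex.exp_add]
    congr 2
    push_cast
    ring
  · have : IsFiniteMeasure (volume.restrict (Set.uIoc (-r) r)) :=
      inferInstanceAs (IsFiniteMeasure (volume.restrict (Set.Ioc _ _)))
    have h : Integrable (fun p : ℝ × ℝ => (1 : ℂ) * (𝓕 ρ) p.2)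
        ((volume.restrict (Set.uIoc (-r) r)).prod volume) :=
      Integrable.mul_prod (f := fun _ : ℝ => (1 : ℂ)) (g := fun t => (𝓕 ρ) t)
        (integrable_const _) (𝓕 ρ).integrable
    refine h.mono ?_ (ae_of_all _ fun p => ?_)
    · refine Continuous.aestronglyMeasurable ?_
      have := (𝓕 ρ).continuous
      unfold Function.uncurry
      fun_prop
    · simp only [Function.uncurry, norm_mul, Complex.norm_exp_ofReal_mul_I, norm_one, le_refl]

theorem integral_exp_mul_truncKernel_eq_one {ρ : 𝓢(ℝ, ℂ)} (hρ : ∀ x, 1 ≤ |x| → ρ x = 0)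
    (hρ1 : ∫ x, ρ x = 1) {r x : ℝ} (hx : |x| ≤ r - 1) :
    ∫ t : ℝ, Complex.exp ((-(2 * Real.pi * x * t) : ℝ) * Complex.I) * truncKernel ρ r t = 1 := by
  obtain ⟨h1, h2⟩ := abs_le.1 hx
  rw [integral_exp_mul_truncKernel, intervalIntegral.integral_comp_sub_right (fun u => ρ u),
    intervalIntegral.integral_of_le (by linarith), ← hρ1]
  refine setIntegral_eq_integral_of_forall_compl_eq_zero fun y hy => hρ y ?_
  by_contra! h
  obtain ⟨h3, h4⟩ := abs_lt.1 h
  exact hy ⟨by linarith, by linarith⟩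

theorem integral_exp_mul_truncKernel_eq_zero {ρ : 𝓢(ℝ, ℂ)} (hρ : ∀ x, 1 ≤ |x| → ρ x = 0)
    {r x : ℝ} (hr : 0 ≤ r) (hx : r + 1 ≤ x) :
    ∫ t : ℝ, Complex.exp ((-(2 * Real.pi * x * t) : ℝ) * Complex.I) * truncKernel ρ r t = 0 := by
  rw [integral_exp_mul_truncKernel]
  refine intervalIntegral.integral_zero_ae (ae_of_all _ fun u hu => hρ _ ?_)
  rw [Set.uIoc_of_le (by linarith)] at hu
  rw [le_abs]
  right
  linarith [hu.2]

/-- For `|t| ≤ 1`, `|t| ^ (k - 1)` has integral `2 / k` and `𝓕 ρ` is bounded; for `|t| > 1` the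
power is at most `1` and `𝓕 ρ` is integrable. Thus `A` depends on `ρ` alone. -/
theorem exists_integral_norm_truncKernel_le (ρ : 𝓢(ℝ, ℂ)) :
    ∃ A : ℝ, 0 < A ∧ ∀ r k : ℝ, 0 < r → 0 < k → k ≤ 1 →
      ∫ t, ‖truncKernel ρ r t‖ ≤ A * (r ^ k / k) := by
  obtain ⟨M, hM, hMb⟩ := (𝓕 ρ).decay 0 0
  have hG : ∀ t, ‖(𝓕 ρ) t‖ ≤ M := fun t => by simpa using hMb t
  have hI : 0 ≤ ∫ t, ‖(𝓕 ρ) t‖ := integral_nonneg fun t => norm_nonneg _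
  refine ⟨2 * (2 * M + ∫ t, ‖(𝓕 ρ) t‖), by positivity, fun r k hr hk hk1 => ?_⟩
  let g : ℝ → ℝ := (Iic 1).indicator fun t => t ^ (k - 1)
  have hg2 : ∫ t in Ioi 0, g t = 1 / k := by
    rw [setIntegral_indicator measurableSet_Iic, Ioi_inter_Iic,
      ← intervalIntegral.integral_of_le zero_le_one, integral_rpow (Or.inl (by linarith))]
    simp [hk.ne']
  have hgi : ∫ t, g |t| = 2 / k := by
    rw [integral_comp_abs, hg2]
    ring
  -- The integral of a non-integrable function is `0` by convention, whereas this one is `2 / k`.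
  have hga : Integrable fun t => g |t| :=
    not_imp_comm.1 integral_undef (by rw [hgi]; positivity)
  have hpt : ∀ᵐ t : ℝ, ‖truncKernel ρ r t‖ ≤ 2 * r ^ k * (M * g |t| + ‖(𝓕 ρ) t‖) := by
    have hne : ∀ᵐ t : ℝ, t ≠ 0 := by simp [ae_iff]
    filter_upwards [hne] with t ht
    have hp : (0 : ℝ) < |t| := abs_pos.2 ht
    rw [truncKernel, norm_mul]
    have key : |t| ^ (k - 1) * ‖(𝓕 ρ) t‖ ≤ M * g |t| + ‖(𝓕 ρ) t‖ := by
      rcases le_or_gt |t| 1 with h | h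
      · have : g |t| = |t| ^ (k - 1) := indicator_of_mem (mem_Iic.2 h) _
        rw [this]
        have := mul_le_mul_of_nonneg_left (hG t) (Real.rpow_nonneg hp.le (k - 1))
        linarith [norm_nonneg ((𝓕 ρ) t)]
      · have h0 : g |t| = 0 := indicator_of_notMem (notMem_Iic.2 h) _
        have h1 : |t| ^ (k - 1) ≤ 1 := Real.rpow_le_one_of_one_le_of_nonpos h.le (by linarith)
        rw [h0]
        nlinarith [norm_nonneg ((𝓕 ρ) t)]
    calc _ ≤ 2 * r ^ k * |t| ^ (k - 1) * ‖(𝓕 ρ) t‖ := by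
          gcongr
          exact norm_dirichletKernel_le_rpow hr hk hk1 ht
      _ = 2 * r ^ k * (|t| ^ (k - 1) * ‖(𝓕 ρ) t‖) := by ring
      _ ≤ _ := by gcongr
  have hint : Integrable fun t => M * g |t| + ‖(𝓕 ρ) t‖ :=
    (hga.const_mul M).add (𝓕 ρ).integrable.norm
  calc ∫ t, ‖truncKernel ρ r t‖ ≤ ∫ t, 2 * r ^ k * (M * g |t| + ‖(𝓕 ρ) t‖) := by
        exact integral_mono_ae (integrable_truncKernel ρ hr.le).norm (hint.const_mul (2 * r ^ k)) hpt
    _ = 2 * r ^ k * (M * (2 / k) + ∫ t, ‖(𝓕 ρ) t‖) := by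
        rw [integral_const_mul, integral_add (hga.const_mul M) (𝓕 ρ).integrable.norm,
          integral_const_mul, hgi]
    _ ≤ 2 * r ^ k * (M * (2 / k) + (∫ t, ‖(𝓕 ρ) t‖) / k) := by
        gcongr
        exact le_div_self hI hk hk1
    _ = _ := by ring

/-! ### Abel summation and convergence in half planes. -/

/-- The difference is the integral of the derivative. The real exponentials on the right telescope
when summed over the frequencies. -/
theorem norm_exp_sub_exp_le {w : ℂ} (hw : 0 < w.re) {x y : ℝ} (hxy : x ≤ y) :
    ‖Complex.exp (-(y : ℂ) * w) - Complex.exp (-(x : ℂ) * w)‖ ≤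
      ‖w‖ / w.re * (Real.exp (-x * w.re) - Real.exp (-y * w.re)) := by
  have hw0 : w ≠ 0 := by
    rintro rfl
    simp at hw
  have h1 := integral_exp_mul_complex (a := x) (b := y) (neg_ne_zero.2 hw0)
  have h2 : ∫ u in x..y, Real.exp (-w.re * u) =
      (Real.exp (-x * w.re) - Real.exp (-y * w.re)) / w.re := by
    have : ∀ u ∈ uIcc x y, HasDerivAt (fun u => Real.exp (-w.re * u) / (-w.re))
        (Real.exp (-w.re * u)) u := by
      intro u _
      have := (((hasDerivAt_id u).const_mul (-w.re)).exp).div_const (-w.re)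
      rwa [mul_one, mul_div_cancel_right₀ _ (neg_ne_zero.2 hw.ne')] at this
    rw [intervalIntegral.integral_eq_sub_of_hasDerivAt this
      (Continuous.intervalIntegrable (by fun_prop) _ _)]
    rw [div_neg, div_neg, neg_mul_comm, neg_mul_comm, mul_comm w.re, mul_comm w.re]
    ring
  have h3 : ‖∫ u in x..y, Complex.exp (-w * u)‖ ≤ ∫ u in x..y, Real.exp (-w.re * u) := by
    refine (intervalIntegral.norm_integral_le_integral_norm hxy).trans_eq ?_
    congr 1
    ext u
    rw [Complex.norm_exp]
    simp
  have h4 : Complex.exp (-(y : ℂ) * w) - Complex.exp (-(x : ℂ) * w) =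
      -w * ∫ u in x..y, Complex.exp (-w * u) := by
    rw [h1]
    field_simp
  rw [h4, norm_mul, norm_neg]
  calc _ ≤ ‖w‖ * ((Real.exp (-x * w.re) - Real.exp (-y * w.re)) / w.re) := by
        gcongr
        exact h3.trans_eq h2
    _ = _ := by ring

/-- Abel summation: the partial sums at `s` in terms of those at `s₀`. -/
theorem partialSum_succ_eq (lam : ℕ → ℝ) (a : ℕ → ℂ) (s₀ s : ℂ) (M : ℕ) :
    partialSum lam a (M + 1) s =
      partialSum lam a (M + 1) s₀ * Complex.exp (-(lam M : ℂ) * (s - s₀)) -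
      ∑ n ∈ Finset.range M, partialSum lam a (n + 1) s₀ *
        (Complex.exp (-(lam (n + 1) : ℂ) * (s - s₀)) - Complex.exp (-(lam n : ℂ) * (s - s₀))) := by
  have hs : ∀ n, Complex.exp (-(lam n : ℂ) * s) =
      Complex.exp (-(lam n : ℂ) * s₀) * Complex.exp (-(lam n : ℂ) * (s - s₀)) := by
    intro n
    rw [← Complex.exp_add]
    ring_nf
  induction M with
  | zero =>
    simp only [partialSum, zero_add, Finset.sum_range_one, Finset.range_zero, Finset.sum_empty,
      sub_zero, hs 0, mul_assoc]
  | succ M ih =>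
    rw [Finset.sum_range_succ]
    have h1 : ∀ z, partialSum lam a (M + 1 + 1) z =
        partialSum lam a (M + 1) z + a (M + 1) * Complex.exp (-(lam (M + 1) : ℂ) * z) :=
      fun z => Finset.sum_range_succ _ _
    rw [h1 s, h1 s₀, ih, hs (M + 1)]
    ring

theorem sum_norm_abel_le {lam : ℕ → ℝ} (hlam : IsFrequency lam) {a : ℕ → ℂ} {s₀ s : ℂ} {B : ℝ}
    (hB : ∀ n, ‖partialSum lam a n s₀‖ ≤ B) (hs : 0 < (s - s₀).re) (M : ℕ) :
    ∑ n ∈ Finset.range M, ‖partialSum lam a (n + 1) s₀ *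
        (Complex.exp (-(lam (n + 1) : ℂ) * (s - s₀)) - Complex.exp (-(lam n : ℂ) * (s - s₀)))‖ ≤
      B * (‖s - s₀‖ / (s - s₀).re) := by
  set w := s - s₀
  have hB0 : 0 ≤ B := (norm_nonneg _).trans (hB 0)
  calc _ ≤ ∑ n ∈ Finset.range M, B * (‖w‖ / w.re *
          (Real.exp (-lam n * w.re) - Real.exp (-lam (n + 1) * w.re))) := by
        refine Finset.sum_le_sum fun n _ => ?_
        rw [norm_mul]
        exact mul_le_mul (hB _) (norm_exp_sub_exp_le hs (hlam.strictMono.monotone n.le_succ))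
          (norm_nonneg _) hB0
    _ = B * (‖w‖ / w.re * (Real.exp (-lam 0 * w.re) - Real.exp (-lam M * w.re))) := by
        rw [← Finset.mul_sum, ← Finset.mul_sum, Finset.sum_range_sub']
    _ ≤ B * (‖w‖ / w.re * 1) := by
        gcongr
        have h1 : Real.exp (-lam 0 * w.re) ≤ 1 := by
          rw [Real.exp_le_one_iff]
          nlinarith [hlam.nonneg 0]
        linarith [Real.exp_pos (-lam M * w.re)]
    _ = _ := by ring

theorem norm_partialSum_le {lam : ℕ → ℝ} (hlam : IsFrequency lam) {a : ℕ → ℂ} {s₀ s : ℂ} {B : ℝ}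
    (hB : ∀ n, ‖partialSum lam a n s₀‖ ≤ B) (hs : 0 < (s - s₀).re) (M : ℕ) :
    ‖partialSum lam a M s‖ ≤ B * (1 + ‖s - s₀‖ / (s - s₀).re) := by
  have hB0 : 0 ≤ B := (norm_nonneg _).trans (hB 0)
  rcases M with _ | M
  · simp only [partialSum, Finset.range_zero, Finset.sum_empty, norm_zero]
    positivity
  · rw [partialSum_succ_eq lam a s₀ s M]
    have h1 : ‖Complex.exp (-(lam M : ℂ) * (s - s₀))‖ ≤ 1 := by
      rw [Complex.norm_exp, Real.exp_le_one_iff, ← Complex.ofReal_neg, Complex.re_ofReal_mul]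
      nlinarith [hlam.nonneg M]
    calc _ ≤ ‖partialSum lam a (M + 1) s₀‖ * ‖Complex.exp (-(lam M : ℂ) * (s - s₀))‖ +
          ∑ n ∈ Finset.range M, ‖partialSum lam a (n + 1) s₀ *
            (Complex.exp (-(lam (n + 1) : ℂ) * (s - s₀)) -
              Complex.exp (-(lam n : ℂ) * (s - s₀)))‖ := by
          refine (norm_sub_le _ _).trans ?_
          rw [norm_mul]
          gcongr
          exact norm_sum_le _ _
      _ ≤ B * 1 + B * (‖s - s₀‖ / (s - s₀).re) := by
          gcongr
          · exact hB _
          · exact sum_norm_abel_le hlam hB hs M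
      _ = _ := by ring

theorem exists_norm_partialSum_le {lam : ℕ → ℝ} {a : ℕ → ℂ} {s₀ : ℂ}
    (h : ConvergesAt lam a s₀) : ∃ B, ∀ n, ‖partialSum lam a n s₀‖ ≤ B := by
  obtain ⟨z, hz⟩ := h
  obtain ⟨B, hB⟩ := (Metric.isBounded_range_of_tendsto _ hz).exists_norm_le
  exact ⟨B, fun n => hB _ (mem_range_self n)⟩

theorem ConvergesAt.of_re_lt {lam : ℕ → ℝ} (hlam : IsFrequency lam) {a : ℕ → ℂ} {s₀ s : ℂ}
    (h : ConvergesAt lam a s₀) (hs : s₀.re < s.re) : ConvergesAt lam a s := by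
  obtain ⟨B, hB⟩ := exists_norm_partialSum_le h
  have hw : 0 < (s - s₀).re := by simpa using hs
  have hsum := summable_of_sum_range_le (fun n => norm_nonneg _) (sum_norm_abel_le hlam hB hw)
  obtain ⟨z, hz⟩ := hsum.of_norm
  have hexp : Tendsto (fun M => Complex.exp (-(lam M : ℂ) * (s - s₀))) atTop (𝓝 0) := by
    rw [tendsto_zero_iff_norm_tendsto_zero]
    have : ∀ M, ‖Complex.exp (-(lam M : ℂ) * (s - s₀))‖ = Real.exp (-(lam M * (s - s₀).re)) := by
      intro M
      rw [Complex.norm_exp, ← Complex.ofReal_neg, Complex.re_ofReal_mul, neg_mul]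
    simp_rw [this]
    exact Real.tendsto_exp_neg_atTop_nhds_zero.comp (hlam.tendsto_atTop.atTop_mul_const hw)
  obtain ⟨z₀, hz₀⟩ := h
  refine ⟨z₀ * 0 - z, (tendsto_add_atTop_iff_nat 1).1 ?_⟩
  simp_rw [partialSum_succ_eq lam a s₀ s]
  exact (((tendsto_add_atTop_iff_nat 1).2 hz₀).mul hexp).sub hz.tendsto_sum_nat

/-! ### The bounded extension and its vertical averages. -/

theorem IsBoundedExtension.hasValueAt {lam : ℕ → ℝ} (hlam : IsFrequency lam) {a : ℕ → ℂ}
    {f : ℂ → ℂ} (hf : IsBoundedExtension lam a f) {s₀ s : ℂ} (h : ConvergesAt lam a s₀)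
    (hs : 0 < s.re) (hs₀ : s₀.re < s.re) : HasValueAt lam a s (f s) := by
  refine hf.extends_sum s hs (lt_of_le_of_lt (sInf_le ⟨s₀.re, fun z hz => ?_, rfl⟩)
    (EReal.coe_lt_coe_iff.2 hs₀))
  exact h.of_re_lt hlam hz

theorem IsBoundedExtension.norm_le_supNorm {lam : ℕ → ℝ} {a : ℕ → ℂ} {f : ℂ → ℂ}
    (hf : IsBoundedExtension lam a f) {s : ℂ} (hs : 0 < s.re) : ‖f s‖ ≤ supNorm f := by
  obtain ⟨M, hM⟩ := hf.bounded
  exact le_ciSup (f := fun s : rightHalfPlane => ‖f s‖)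
    ⟨M, by rintro _ ⟨z, rfl⟩; exact hM z z.2⟩ ⟨s, hs⟩

theorem isOpen_rightHalfPlane : IsOpen rightHalfPlane :=
  isOpen_lt continuous_const Complex.continuous_re

theorem add_ofReal_mul_I_re (s : ℂ) (x : ℝ) : (s + x * Complex.I).re = s.re := by simp

theorem continuous_comp_vertical_line {f : ℂ → ℂ} (hf : DifferentiableOn ℂ f rightHalfPlane)
    {s : ℂ} (hs : 0 < s.re) (h : ℝ) : Continuous fun t : ℝ => f (s + (h * t : ℝ) * Complex.I) :=
  hf.continuousOn.comp_continuous (by fun_prop) fun t => by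
    rw [rightHalfPlane, mem_ofPred_eq, add_ofReal_mul_I_re]
    exact hs

/-- Averages of a bounded holomorphic function along vertical lines are holomorphic. -/
theorem differentiableOn_integral_vertical {f : ℂ → ℂ} (hf : DifferentiableOn ℂ f rightHalfPlane)
    {M : ℝ} (hM : ∀ s ∈ rightHalfPlane, ‖f s‖ ≤ M) {K : ℝ → ℂ} (hKc : Continuous K)
    (hK : Integrable K) (h : ℝ) :
    DifferentiableOn ℂ (fun s => ∫ t, f (s + (h * t : ℝ) * Complex.I) * K t) rightHalfPlane := by
  intro s hs
  have hs' : 0 < s.re := hs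
  set δ := s.re / 4 with hδ
  have hδ0 : 0 < δ := by positivity
  -- With `δ = s.re / 4`, discs of radius `δ` around vertical translates of points of `ball s δ`
  -- stay in the half plane, so Cauchy's estimate bounds `deriv f` there by `M / δ`.
  have hre : ∀ z : ℂ, ∀ t : ℝ, δ < z.re → (∀ w, dist w (z + (h * t : ℝ) * Complex.I) ≤ δ →
      w ∈ rightHalfPlane) := by
    intro z t hz w hw
    rw [dist_eq_norm] at hw
    have h1 := (abs_le.1 ((Complex.abs_re_le_norm _).trans hw)).1
    rw [Complex.sub_re, add_ofReal_mul_I_re] at h1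
    change 0 < w.re
    linarith
  have hball : ∀ z ∈ Metric.ball s δ, δ < z.re := by
    intro z hz
    rw [Metric.mem_ball, dist_eq_norm] at hz
    have h1 := (abs_lt.1 ((Complex.abs_re_le_norm _).trans_lt hz)).1
    rw [Complex.sub_re] at h1
    linarith
  have hdf : ∀ z ∈ rightHalfPlane, DifferentiableAt ℂ f z := fun z hz =>
    hf.differentiableAt (isOpen_rightHalfPlane.mem_nhds hz)
  have hderiv : DifferentiableOn ℂ (deriv f) rightHalfPlane := hf.deriv isOpen_rightHalfPlane
  have hmain := hasDerivAt_integral_of_dominated_loc_of_deriv_le (μ := volume)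
    (F := fun s t => f (s + (h * t : ℝ) * Complex.I) * K t)
    (F' := fun s t => deriv f (s + (h * t : ℝ) * Complex.I) * K t)
    (bound := fun t => M / δ * ‖K t‖) (x₀ := s) (Metric.ball_mem_nhds s hδ0)
    ?_ ?_ ?_ ?_ ?_ ?_
  · exact hmain.2.differentiableAt.differentiableWithinAt
  · filter_upwards [isOpen_rightHalfPlane.mem_nhds hs] with z hz
    exact ((continuous_comp_vertical_line hf hz h).mul hKc).aestronglyMeasurable
  · refine Integrable.mono' (hK.norm.const_mul M)
      ((continuous_comp_vertical_line hf hs' h).mul hKc).aestronglyMeasurable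
      (ae_of_all _ fun t => ?_)
    rw [norm_mul]
    gcongr
    refine hM _ ?_
    rw [rightHalfPlane, mem_ofPred_eq, add_ofReal_mul_I_re]
    exact hs
  · exact ((continuous_comp_vertical_line hderiv hs' h).mul hKc).aestronglyMeasurable
  · refine ae_of_all _ fun t z hz => ?_
    rw [norm_mul]
    gcongr
    have hz' := hre z t (hball z hz)
    refine Complex.norm_deriv_le_of_forall_mem_sphere_norm_le hδ0 ?_
      fun w hw => hM w (hz' w (le_of_eq hw))
    refine DifferentiableOn.diffContOnCl (hf.mono fun w hw => hz' w ?_)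
    exact Metric.closure_ball_subset_closedBall hw
  · exact hK.norm.const_mul _
  · refine ae_of_all _ fun t z hz => ?_
    have hz' := hre z t (hball z hz) _ (by rw [dist_self]; exact hδ0.le)
    exact ((hdf _ hz').hasDerivAt.comp_add_const z _).mul_const (K t)

/-! ### Partial sums as averages of the extension. -/

theorem integral_partialSum_mul_truncKernel {ρ : 𝓢(ℝ, ℂ)} {r : ℝ} (hr : 0 ≤ r)
    (lam : ℕ → ℝ) (a : ℕ → ℂ) (η : ℝ) (M : ℕ) (s : ℂ) :
    ∫ t : ℝ, partialSum lam a M (s + (2 * Real.pi / η * t : ℝ) * Complex.I) * truncKernel ρ r t =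
      ∑ n ∈ Finset.range M, a n * Complex.exp (-(lam n : ℂ) * s) *
        ∫ t : ℝ, Complex.exp ((-(2 * Real.pi * (lam n / η) * t) : ℝ) * Complex.I) *
          truncKernel ρ r t := by
  simp_rw [partialSum, Finset.sum_mul, ← integral_const_mul]
  rw [← integral_finsetSum]
  · refine integral_congr_ae (ae_of_all _ fun t => Finset.sum_congr rfl fun n _ => ?_)
    have : Complex.exp (-(lam n : ℂ) * (s + (2 * Real.pi / η * t : ℝ) * Complex.I)) =
        Complex.exp (-(lam n : ℂ) * s) *
          Complex.exp ((-(2 * Real.pi * (lam n / η) * t) : ℝ) * Complex.I) := by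
      rw [← Complex.exp_add]
      congr 1
      push_cast
      ring
    simp only [this]
    ring
  · intro n _
    refine Integrable.const_mul ?_ _
    refine (integrable_truncKernel ρ hr).norm.mono' ?_ (ae_of_all _ fun t => ?_)
    · have := continuous_truncKernel ρ r
      exact Continuous.aestronglyMeasurable (by fun_prop)
    · rw [norm_mul, Complex.norm_exp_ofReal_mul_I, one_mul]

theorem partialSum_eq_integral_of_re_gt {ρ : 𝓢(ℝ, ℂ)} (hρ : ∀ x, 1 ≤ |x| → ρ x = 0)
    (hρ1 : ∫ x, ρ x = 1) {lam : ℕ → ℝ} (hlam : IsFrequency lam) {a : ℕ → ℂ} {f : ℂ → ℂ}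
    (hf : IsBoundedExtension lam a f) {r η : ℝ} (hr : 0 ≤ r) (hη : 0 < η) {N : ℕ}
    (hN : lam N / η ≤ r - 1) (hN' : r + 1 ≤ lam (N + 1) / η) {s₀ s : ℂ}
    (h₀ : ConvergesAt lam a s₀) (hs : 0 < s.re) (hs₀ : s₀.re < s.re) :
    partialSum lam a (N + 1) s =
      ∫ t : ℝ, f (s + (2 * Real.pi / η * t : ℝ) * Complex.I) * truncKernel ρ r t := by
  obtain ⟨B, hB⟩ := exists_norm_partialSum_le h₀
  have hB0 : 0 ≤ B := (norm_nonneg _).trans (hB 0)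
  set h := 2 * Real.pi / η with hh
  have hh0 : 0 ≤ h := by have := Real.pi_pos; positivity
  have hw : 0 < (s - s₀).re := by simpa using hs₀
  have hlim : Tendsto (fun M => ∫ t : ℝ, partialSum lam a M (s + (h * t : ℝ) * Complex.I) *
      truncKernel ρ r t) atTop
      (𝓝 (∫ t : ℝ, f (s + (h * t : ℝ) * Complex.I) * truncKernel ρ r t)) := by
    -- On the vertical line `norm_partialSum_le` gives a bound `A * (1 + |t|)` uniform in `M`, as
    -- domination requires.
    set A := B * (1 + (‖s - s₀‖ + h) / (s - s₀).re) with hA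
    refine tendsto_integral_of_dominated_convergence
      (fun t => A * ((1 + |t|) * ‖truncKernel ρ r t‖)) (fun M => ?_)
      ((integrable_one_add_abs_mul_truncKernel ρ hr).const_mul A)
      (fun M => ae_of_all _ fun t => ?_) (ae_of_all _ fun t => ?_)
    · have := continuous_truncKernel ρ r
      unfold partialSum
      exact Continuous.aestronglyMeasurable (by fun_prop)
    · rw [norm_mul, ← mul_assoc]
      gcongr
      have hsub : s + (h * t : ℝ) * Complex.I - s₀ = s - s₀ + (h * t : ℝ) * Complex.I := by ring
      have hre : (s + (h * t : ℝ) * Complex.I - s₀).re = (s - s₀).re := by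
        rw [hsub, add_ofReal_mul_I_re]
      have hnorm : ‖s + (h * t : ℝ) * Complex.I - s₀‖ ≤ ‖s - s₀‖ + h * |t| := by
        rw [hsub]
        refine (norm_add_le _ _).trans_eq ?_
        rw [norm_mul, Complex.norm_I, mul_one, Complex.norm_real, Real.norm_eq_abs, abs_mul,
          abs_of_nonneg hh0]
      calc _ ≤ B * (1 + (‖s - s₀‖ + h * |t|) / (s - s₀).re) := by
            refine (norm_partialSum_le hlam hB (hre ▸ hw) M).trans ?_
            rw [hre]
            gcongr
        _ ≤ B * (1 + |t| + (‖s - s₀‖ + h) * (1 + |t|) / (s - s₀).re) := by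
            have := abs_nonneg t
            have := norm_nonneg (s - s₀)
            gcongr
            · linarith
            · nlinarith
        _ = A * (1 + |t|) := by
            rw [hA]
            ring
    · exact (hf.hasValueAt hlam h₀ (by rwa [add_ofReal_mul_I_re])
        (by rwa [add_ofReal_mul_I_re])).mul_const _
  -- The averaged partial sums are constant for `M ≥ N + 1`: the kernel keeps the terms up to index
  -- `N` and annihilates the others.
  refine tendsto_nhds_unique (Tendsto.congr' ?_ tendsto_const_nhds) hlim
  filter_upwards [eventually_ge_atTop (N + 1)] with M hM
  rw [integral_partialSum_mul_truncKernel hr, partialSum,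
    ← Finset.sum_subset (Finset.range_mono hM)]
  · refine Finset.sum_congr rfl fun n hn => ?_
    have hn' : lam n ≤ lam N :=
      hlam.strictMono.monotone (Nat.lt_succ_iff.1 (Finset.mem_range.1 hn))
    rw [integral_exp_mul_truncKernel_eq_one hρ hρ1, mul_one]
    rw [abs_of_nonneg (div_nonneg (hlam.nonneg n) hη.le)]
    exact le_trans (by gcongr) hN
  · intro n _ hn
    have hn' : lam (N + 1) ≤ lam n := hlam.strictMono.monotone (by simpa using hn)
    rw [integral_exp_mul_truncKernel_eq_zero hρ hr, mul_zero]
    exact hN'.trans (by gcongr)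

/-- Both sides are holomorphic on the right half plane and agree near a real point to the right of
`s₀`, so the identity theorem applies. -/
theorem partialSum_eq_integral {ρ : 𝓢(ℝ, ℂ)} (hρ : ∀ x, 1 ≤ |x| → ρ x = 0)
    (hρ1 : ∫ x, ρ x = 1) {lam : ℕ → ℝ} (hlam : IsFrequency lam) {a : ℕ → ℂ} {f : ℂ → ℂ}
    (hf : IsBoundedExtension lam a f) {r η : ℝ} (hr : 0 ≤ r) (hη : 0 < η) {N : ℕ}
    (hN : lam N / η ≤ r - 1) (hN' : r + 1 ≤ lam (N + 1) / η) {s₀ s : ℂ}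
    (h₀ : ConvergesAt lam a s₀) (hs : 0 < s.re) :
    partialSum lam a (N + 1) s =
      ∫ t : ℝ, f (s + (2 * Real.pi / η * t : ℝ) * Complex.I) * truncKernel ρ r t := by
  obtain ⟨M, hM⟩ := hf.bounded
  have h1 : AnalyticOnNhd ℂ (partialSum lam a (N + 1)) rightHalfPlane := by
    refine DifferentiableOn.analyticOnNhd (Differentiable.differentiableOn ?_)
      isOpen_rightHalfPlane
    unfold partialSum
    fun_prop
  have h2 := (differentiableOn_integral_vertical hf.holomorphic hM (continuous_truncKernel ρ r)
    (integrable_truncKernel ρ hr) (2 * Real.pi / η)).analyticOnNhd isOpen_rightHalfPlane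
  have hpre : IsPreconnected rightHalfPlane := (convex_halfSpace_re_gt 0).isPreconnected
  set z₀ : ℂ := ((max 0 s₀.re + 1 : ℝ) : ℂ) with hz₀
  have hz₀re : z₀.re = max 0 s₀.re + 1 := Complex.ofReal_re _
  have hz₀0 : 0 < z₀.re := by rw [hz₀re]; linarith [le_max_left 0 s₀.re]
  have hz₀1 : s₀.re < z₀.re := by rw [hz₀re]; linarith [le_max_right 0 s₀.re]
  refine h1.eqOn_of_preconnected_of_eventuallyEq h2 hpre (z₀ := z₀) hz₀0 ?_ hs
  have hopen : IsOpen {z : ℂ | s₀.re < z.re} := isOpen_lt continuous_const Complex.continuous_re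
  filter_upwards [isOpen_rightHalfPlane.mem_nhds hz₀0, hopen.mem_nhds hz₀1] with z hz hz'
  exact partialSum_eq_integral_of_re_gt hρ hρ1 hlam hf hr hη hN hN' h₀ hz hz'

/-! ### The final estimate. -/

theorem exists_pos_le_Gamma_add_one :
    ∃ c : ℝ, 0 < c ∧ ∀ k : ℝ, 0 ≤ k → k ≤ 1 → c ≤ Real.Gamma (k + 1) := by
  have hcont : ContinuousOn (fun k : ℝ => Real.Gamma (k + 1)) (Icc 0 1) := by
    refine Real.differentiableOn_Gamma_Ioi.continuousOn.comp (by fun_prop) fun k hk => ?_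
    exact mem_Ioi.2 (by linarith [hk.1])
  obtain ⟨k₀, hk₀, hmin⟩ := isCompact_Icc.exists_isMinOn (nonempty_Icc.2 zero_le_one) hcont
  exact ⟨Real.Gamma (k₀ + 1), Real.Gamma_pos_of_pos (by linarith [hk₀.1]),
    fun k h0 h1 => hmin ⟨h0, h1⟩⟩

theorem norm_partialSum_le_mul_integral {ρ : 𝓢(ℝ, ℂ)} (hρ : ∀ x, 1 ≤ |x| → ρ x = 0)
    (hρ1 : ∫ x, ρ x = 1) {lam : ℕ → ℝ} (hlam : IsFrequency lam) {a : ℕ → ℂ} {f : ℂ → ℂ}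
    (hf : IsBoundedExtension lam a f) {s₀ : ℂ} (h₀ : ConvergesAt lam a s₀) (N : ℕ) {s : ℂ}
    (hs : 0 < s.re) :
    ‖partialSum lam a (N + 1) s‖ ≤
      (∫ t, ‖truncKernel ρ ((lam (N + 1) + lam N) / (lam (N + 1) - lam N)) t‖) * supNorm f := by
  have hd : 0 < lam (N + 1) - lam N := sub_pos.2 (hlam.strictMono N.lt_succ_self)
  have hNn := hlam.nonneg N
  have hNn' := hlam.nonneg (N + 1)
  set r := (lam (N + 1) + lam N) / (lam (N + 1) - lam N) with hr
  have hr0 : 0 ≤ r := by positivity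
  -- Dividing by half the gap sends `lam N` to `r - 1` and `lam (N + 1)` to `r + 1`, the ends of the
  -- kernel's transition zone.
  have hη : 0 < (lam (N + 1) - lam N) / 2 := by positivity
  rw [partialSum_eq_integral hρ hρ1 hlam hf hr0 hη (N := N) (le_of_eq (by rw [hr]; field_simp; ring))
    (le_of_eq (by rw [hr]; field_simp; ring)) h₀ hs, ← integral_mul_const]
  refine norm_integral_le_of_norm_le ((integrable_truncKernel ρ hr0).norm.mul_const _)
    (ae_of_all _ fun t => ?_)
  rw [norm_mul, mul_comm]
  gcongr
  exact hf.norm_le_supNorm (by rwa [add_ofReal_mul_I_re])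

end GenDirichlet

/-- Indices start at `0`: the sum of the first `N + 1` terms is bounded through the terms number
`N + 1` (`lam N`) and `N + 2` (`lam (N + 1)`) of the frequency, so every partial sum of positive
length is covered. `supNorm f` is the norm of the series, for its bounded extension `f`. -/
theorem theorem3p1 :
    ∃ C : ℝ, 0 < C ∧
      ∀ lam : ℕ → ℝ, GenDirichlet.IsFrequency lam →
      ∀ k : ℝ, 0 < k → k ≤ 1 →
      ∀ N : ℕ,
      ∀ a ∈ GenDirichlet.DInftyExt lam,
      ∀ f : ℂ → ℂ, GenDirichlet.IsBoundedExtension lam a f →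
      ∀ s ∈ GenDirichlet.rightHalfPlane,
        ‖GenDirichlet.partialSum lam a (N + 1) s‖ ≤
          C * (Real.Gamma (k + 1) / k) * (lam (N + 1) / (lam (N + 1) - lam N)) ^ k *
            GenDirichlet.supNorm f := by
  obtain ⟨ρ, hρ, hρ1⟩ := GenDirichlet.exists_schwartz_bump
  obtain ⟨A, hA, hAb⟩ := GenDirichlet.exists_integral_norm_truncKernel_le ρ
  obtain ⟨c, hc, hcb⟩ := GenDirichlet.exists_pos_le_Gamma_add_one
  -- The `2` comes from `r ^ k ≤ 2 * R ^ k`; dividing by `c` pays for inserting the Gamma factor.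
  refine ⟨2 * A / c, by positivity, fun lam hlam k hk hk1 N a ha f hf s hs => ?_⟩
  obtain ⟨⟨s₀, h₀⟩, _⟩ := ha
  have hlt : lam N < lam (N + 1) := hlam.strictMono N.lt_succ_self
  have hd : 0 < lam (N + 1) - lam N := sub_pos.2 hlt
  have hNn := hlam.nonneg N
  have hNp : 0 < lam (N + 1) := hNn.trans_lt hlt
  have hsup : 0 ≤ GenDirichlet.supNorm f := (norm_nonneg _).trans (hf.norm_le_supNorm hs)
  set R := lam (N + 1) / (lam (N + 1) - lam N) with hR
  have hR0 : 0 < R := by positivity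
  set r := (lam (N + 1) + lam N) / (lam (N + 1) - lam N) with hr
  have hr0 : 0 < r := by positivity
  have hrR : r ≤ 2 * R := by
    rw [hr, hR, ← mul_div_assoc]
    gcongr
    linarith
  have hrk : r ^ k ≤ 2 * R ^ k := by
    calc r ^ k ≤ (2 * R) ^ k := by gcongr
      _ = 2 ^ k * R ^ k := Real.mul_rpow (by norm_num) hR0.le
      _ ≤ 2 * R ^ k := by
          gcongr
          simpa using Real.rpow_le_rpow_of_exponent_le (by norm_num : (1 : ℝ) ≤ 2) hk1
  refine (GenDirichlet.norm_partialSum_le_mul_integral hρ hρ1 hlam hf h₀ N hs).trans ?_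
  gcongr
  calc ∫ t, ‖GenDirichlet.truncKernel ρ r t‖ ≤ A * (r ^ k / k) := hAb r k hr0 hk hk1
    _ ≤ A * (2 * R ^ k / k) := by gcongr
    _ = 2 * A / c * (c / k) * R ^ k := by field_simp
    _ ≤ 2 * A / c * (Real.Gamma (k + 1) / k) * R ^ k := by
        gcongr
        exact hcb k hk.le hk1
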